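/- Let $X$ be a compact metrizable space, $\Delta\subseteq X$ a clopen subset and $\gamma:\Delta\to X$ a continuous map, and let $\alpha:C(X)\to C(X)$ be the endomorphism of the $C^*$-algebra $C(X)$ of continuous complex functions given by $\alpha(a)(x)=a(\gamma(x))$ for $x\in\Delta$ and $\alpha(a)(x)=0$ for $x\notin\Delta$. A transfer operator for $(C(X),\alpha)$ is a continuous positive linear map $L:C(X)\to C(X)$ with $L(\alpha(a)b)=aL(b)$ for all $a,b\in C(X)$; it is non-degenerate if $\alpha(L(1))=\alpha(1)$ (equivalently, $\alpha\circ L\circ\alpha=\alpha$). A lower semicontinuous (l.s.c.) section of $\gamma:\Delta\to\gamma(\Delta)$ is a map $\Phi$ from $\gamma(\Delta)$ to the closed (possibly empty) subsets of $\Delta$ such that $\Phi(x)\subseteq\gamma^{-1}(x)$ for all $x\in\gamma(\Delta)$ and such that $\{x\in\gamma(\Delta):\Phi(x)\cap V\neq\emptyset\}$ is open in $\gamma(\Delta)$ for every open $V\subseteq\Delta$. Then: (i) $(C(X),\alpha)$ admits a non-zero transfer operator if and only if $\gamma:\Delta\to\gamma(\Delta)$ admits an l.s.c. section $\Phi$ that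 is not identically empty on the interior of $\gamma(\Delta)$ in $X$, that is, $\Phi(x)\neq\emptyset$ for some $x\in\operatorname{Int}(\gamma(\Delta))$; (ii) $(C(X),\alpha)$ admits a non-degenerate transfer operator if and only if $\gamma(\Delta)$ is open in $X$ and $\gamma:\Delta\to\gamma(\Delta)$ admits an l.s.c. section $\Phi$ with $\Phi(x)\neq\emptyset$ for all $x\in\gamma(\Delta)$. -/

import Mathlib

open Topology
open scoped ComplexOrder

section TransferOperators

variable {A : Type*} [CStarAlgebra A] [PartialOrder A]

/-- A transfer operator for the `C⋆`-dynamical system `(A, α)`, where `A` is unital and `α` is a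
(not necessarily unital) `*`-endomorphism: a continuous linear positive map `L : A → A` such that
`L (α a * b) = a * L b`. -/
structure IsTransferOperator [StarOrderedRing A] (α : A →⋆ₙₐ[ℂ] A) (L : A →L[ℂ] A) : Prop where
  nonneg : ∀ a : A, 0 ≤ a → 0 ≤ L a
  map_mul : ∀ a b : A, L (α a * b) = a * L b

/-- A transfer operator `L` for `(A, α)` that is non-degenerate: `α (L 1) = α 1`. The two lemmas
below give the other usual forms of this condition. -/
structure IsNonDegenerateTransferOperator [StarOrderedRing A] (α : A →⋆ₙₐ[ℂ] A)
    (L : A →L[ℂ] A) : Prop extends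
    IsTransferOperator α L where
  map_one : α (L 1) = α 1

/-- Non-degeneracy is the identity `α ∘ L ∘ α = α`. -/
theorem isNonDegenerateTransferOperator_iff [StarOrderedRing A] (α : A →⋆ₙₐ[ℂ] A)
    (L : A →L[ℂ] A) :
    IsNonDegenerateTransferOperator α L ↔
      IsTransferOperator α L ∧ ∀ a, α (L (α a)) = α a := by
  constructor
  · intro h
    refine ⟨h.toIsTransferOperator, fun a => ?_⟩
    have h1 := h.map_mul a 1
    rw [mul_one] at h1
    rw [h1, _root_.map_mul, h.map_one, ← _root_.map_mul, mul_one]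
  · rintro ⟨h, h2⟩
    refine ⟨h, ?_⟩
    have h1 := h.map_mul 1 1
    rw [mul_one, one_mul] at h1
    rw [← h1, h2]

/-- Non-degeneracy says that `α ∘ L` is a projection of `A` onto the range of `α`
(it is automatically positive and a bimodule map over that range). -/
theorem isNonDegenerateTransferOperator_iff_projection [StarOrderedRing A] (α : A →⋆ₙₐ[ℂ] A)
    (L : A →L[ℂ] A) :
    IsNonDegenerateTransferOperator α L ↔
      IsTransferOperator α L ∧ (∀ a, α (L (α (L a))) = α (L a)) ∧
        Set.range (fun a => α (L a)) = Set.range α := by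
  rw [isNonDegenerateTransferOperator_iff]
  constructor
  · rintro ⟨h, h2⟩
    refine ⟨h, fun a => h2 _, Set.Subset.antisymm ?_ ?_⟩
    · rintro _ ⟨a, rfl⟩
      exact ⟨_, rfl⟩
    · rintro _ ⟨a, rfl⟩
      exact ⟨α a, h2 a⟩
  · rintro ⟨h, h2, h3⟩
    refine ⟨h, fun a => ?_⟩
    obtain ⟨b, hb⟩ : α a ∈ Set.range (fun a => α (L a)) := h3 ▸ ⟨a, rfl⟩
    simp only at hb
    rw [← hb, h2]

end TransferOperators

section CommutativeSystems

variable {X : Type*} [TopologicalSpace X]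

open Classical in
/-- The endomorphism of `C(X)` given by a clopen set `Δ ⊆ X` and a continuous map `γ : Δ → X`:
`α(a)(x) = a(γ(x))` for `x ∈ Δ`, and `α(a)(x) = 0` for `x ∉ Δ`. -/
noncomputable def partialCompEnd (Δ : TopologicalSpace.Clopens X) (γ : C(Δ, X)) :
    C(X, ℂ) →⋆ₙₐ[ℂ] C(X, ℂ) where
  toFun a :=
    { toFun := fun x => if hx : x ∈ Δ then a (γ ⟨x, hx⟩) else 0
      continuous_toFun := by
        rw [continuous_iff_continuousAt]
        intro x
        by_cases hx : x ∈ Δ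
        · have hc : ContinuousOn
              (fun x => if hx : x ∈ Δ then a (γ ⟨x, hx⟩) else 0) (Δ : Set X) := by
            rw [continuousOn_iff_continuous_domRestrict]
            have : Continuous (fun y : Δ => a (γ y)) := by fun_prop
            refine this.congr fun y => ?_
            simp
          exact hc.continuousAt (Δ.isClopen.isOpen.mem_nhds hx)
        · refine (continuousAt_const (y := (0 : ℂ))).congr ?_
          filter_upwards [Δ.isClopen.compl.isOpen.mem_nhds hx] with y hy
          have hy' : y ∉ Δ := hy
          simp [hy'] }
  map_smul' c a := by ext x; by_cases hx : x ∈ Δ <;> simp [hx]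
  map_zero' := by ext x; simp
  map_add' a b := by ext x; by_cases hx : x ∈ Δ <;> simp [hx]
  map_mul' a b := by ext x; by_cases hx : x ∈ Δ <;> simp [hx]
  map_star' a := by ext x; by_cases hx : x ∈ Δ <;> simp [hx]

/-- A lower semicontinuous section of `γ : Δ → γ(Δ)`: a map `Φ` from `γ(Δ)` to the closed subsets
of `Δ` (possibly empty) with `Φ(x) ⊆ γ⁻¹(x)`, such that `{x ∈ γ(Δ) : Φ(x) ∩ V ≠ ∅}` is open in
`γ(Δ)` for every open `V ⊆ Δ`; the last condition is `LowerHemicontinuous`, by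
`lowerHemicontinuous_iff_isOpen_inter_nonempty`. -/
structure IsLSCSection {Δ : TopologicalSpace.Clopens X} (γ : C(Δ, X))
    (Φ : Set.range γ → TopologicalSpace.Closeds Δ) : Prop where
  subset_fiber : ∀ x : Set.range γ, (Φ x : Set Δ) ⊆ γ ⁻¹' {(x : X)}
  lsc : LowerHemicontinuous fun x : Set.range γ => (Φ x : Set Δ)

end CommutativeSystems

/-!
A positive functional on `C(X)` has a support, and transfer operators correspond to continuous
families of positive functionals supported in the fibres of `γ`.

Given a transfer operator `L`, let `Φ y` be the support of the functional `b ↦ L b y`. The identity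
`L (α a * b) = a * L b` forces `Φ y ⊆ γ⁻¹(y)`, and it makes `L 1` vanish off the range of `γ`, so
that the open set `{L 1 ≠ 0}` lies in the interior of the range. Lower semicontinuity holds because
`Φ y` meets an open set `V` as soon as some positive `b` supported in `V` has `L b y ≠ 0`, which is
an open condition on `y` (`exists_mem_positiveSupport`, `IsTransferOperator.exists_isLSCSection`).

Conversely, let `Φ` be a lower semicontinuous section, and choose a continuous `ρ : X → [0, 1]` which
vanishes outside the set of interior points of the range where `Φ` is nonempty: a Urysohn function
for the existence of a nonzero operator, the indicator function of the range for a non-degenerate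
one. To each `y` attach the convex hull of the functionals `ρ y • ev_z` with `z ∈ Φ y`, or of the zero
functional if `ρ y = 0`. The factor `ρ` makes this a lower hemicontinuous map on all of `X`. A
continuous selection `y ↦ g y` of its pointwise closure yields the transfer operator
`L b y = g y b`, with `L 1 = ρ` (`IsLSCSection.exists_isTransferOperator`).

The selection is obtained as in Michael's theorem, by successive approximation with partitions of
unity (`LowerHemicontinuous.exists_continuous_mem_closure`). The functionals are contractions and
`C(X)` is separable because `X` is metrizable, so finitely many elements of a dense sequence are
controlled at each stage, and this suffices for uniform convergence.
-/

open Filter Set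

/-! ### A selection theorem of Michael type -/

section Selection

variable {X E : Type*} [TopologicalSpace X] [AddCommGroup E] [Module ℝ E] [TopologicalSpace E]
  [IsTopologicalAddGroup E] [ContinuousSMul ℝ E]

theorem LowerHemicontinuous.convexHull {F : X → Set E} (hF : LowerHemicontinuous F) :
    LowerHemicontinuous fun x => convexHull ℝ (F x) := by
  intro x₀
  refine lowerHemicontinuousAt_iff.mpr ?_
  rintro U hU ⟨e₀, he₀, he₀U⟩
  -- The points all of whose neighbourhoods meet the hulls near `x₀`; they form a convex set.
  let C : Set E := {e | ∀ V : Set E, IsOpen V → e ∈ V →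
    ∀ᶠ x in 𝓝 x₀, (_root_.convexHull ℝ (F x) ∩ V).Nonempty}
  have hC : Convex ℝ C := by
    intro e₁ h₁ e₂ h₂ a b ha hb hab V hV heV
    have hcont : Continuous fun p : E × E => a • p.1 + b • p.2 := by fun_prop
    obtain ⟨V₁, V₂, hV₁, hV₂, he₁, he₂, hVV⟩ :=
      isOpen_prod_iff.mp (hV.preimage hcont) e₁ e₂ heV
    filter_upwards [h₁ V₁ hV₁ he₁, h₂ V₂ hV₂ he₂]
    rintro x ⟨u, hu, huV⟩ ⟨v, hv, hvV⟩
    exact ⟨a • u + b • v, convex_convexHull ℝ (F x) hu hv ha hb hab,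
      hVV (Set.mk_mem_prod huV hvV)⟩
  have hsub : F x₀ ⊆ C := fun e he V hV heV =>
    ((lowerHemicontinuousAt_iff.mp (hF x₀)) V hV ⟨e, he, heV⟩).mono fun x hx =>
      hx.mono (Set.inter_subset_inter_left _ (subset_convexHull ℝ _))
  exact convexHull_min hsub hC he₀ U hU he₀U

/-- The approximation step: a continuous map `g` that is `V`-close to a convex-valued lower
hemicontinuous `F` can be moved by less than `V` to become `V'`-close to `F`. The set of admissible
values at `y` is convex, and any point of `F x` that is `V`-close to `g x` is admissible near `x`. -/
theorem LowerHemicontinuous.exists_continuous_approx [NormalSpace X] [ParacompactSpace X]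
    {F : X → Set E} (hF : LowerHemicontinuous F) (hconv : ∀ x, Convex ℝ (F x))
    {P V V' : Set E} (hP : Convex ℝ P) (hFP : ∀ x, F x ⊆ P)
    (hV : Convex ℝ V) (hVo : IsOpen V) (hV' : Convex ℝ V') (hVo' : IsOpen V') (h0 : (0 : E) ∈ V')
    (g : C(X, E)) (hg : ∀ x, ∃ e ∈ F x, e - g x ∈ V) :
    ∃ g' : C(X, E), ∀ x, g' x - g x ∈ V ∧ g' x ∈ P ∧ ∃ e ∈ F x, e - g' x ∈ V' := by
  refine exists_continuous_forall_mem_convex_of_local_const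
    (t := fun x => {v | v - g x ∈ V ∧ v ∈ P ∧ ∃ e ∈ F x, e - v ∈ V'}) ?_ ?_
  · rintro x u ⟨hu, huP, e, he, heu⟩ v ⟨hv, hvP, f, hf, hfv⟩ a b ha hb hab
    refine ⟨?_, hP huP hvP ha hb hab, a • e + b • f, hconv x he hf ha hb hab, ?_⟩
    · convert hV hu hv ha hb hab using 1
      have : g x = a • g x + b • g x := by rw [← add_smul, hab, one_smul]
      rw [smul_sub, smul_sub]
      nth_rewrite 1 [this]
      abel
    · convert hV' heu hfv ha hb hab using 1
      rw [smul_sub, smul_sub]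
      abel
  · intro x
    obtain ⟨e, he, hge⟩ := hg x
    refine ⟨e, ?_⟩
    have h1 : ∀ᶠ y in 𝓝 x, e - g y ∈ V :=
      (by fun_prop : Continuous fun y => e - g y).continuousAt.eventually_mem (hVo.mem_nhds hge)
    have h2 : ∀ᶠ y in 𝓝 x, (F y ∩ (fun v => v - e) ⁻¹' V').Nonempty :=
      (lowerHemicontinuousAt_iff.mp (hF x)) _ (hVo'.preimage (by fun_prop))
        ⟨e, he, by simpa using h0⟩
    filter_upwards [h1, h2] with y hy1 hy2
    obtain ⟨f, hf, hfe⟩ := hy2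
    exact ⟨hy1, hFP x he, f, hf, hfe⟩

end Selection

section PointwiseSelection

variable {X B W : Type*} [TopologicalSpace X] [CompactSpace X] [T2Space X]
  [PseudoMetricSpace B] [TopologicalSpace.SeparableSpace B] [Nonempty B]
  [NormedAddCommGroup W] [NormedSpace ℝ W] [CompleteSpace W]

/-- A selection theorem of Michael type for maps into a space `B → W` of functions with the
topology of pointwise convergence: a lower hemicontinuous map with nonempty convex values consisting
of `1`-Lipschitz functions on a separable space has a continuous selection of its pointwise closure.
The Lipschitz bound makes a dense sequence in `B` control the topology. -/
theorem LowerHemicontinuous.exists_continuous_mem_closure {F : X → Set (B → W)}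
    (hF : LowerHemicontinuous F) (hconv : ∀ x, Convex ℝ (F x)) (hne : ∀ x, (F x).Nonempty)
    (hlip : ∀ x, ∀ e ∈ F x, ∀ b c, dist (e b) (e c) ≤ dist b c) :
    ∃ g : C(X, B → W), ∀ x, g x ∈ closure (F x) := by
  let f : ℕ → B := TopologicalSpace.denseSeq B
  have hf : DenseRange f := TopologicalSpace.denseRange_denseSeq B
  -- Membership in `P` keeps the approximations, which need not lie in `F x`, equicontinuous on `B`.
  let P : Set (B → W) := {e | ∀ b c, ‖e b - e c‖ ≤ dist b c}
  have hP : Convex ℝ P := by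
    intro u hu v hv s t hs ht hst b c
    have : (s • u + t • v) b - (s • u + t • v) c = s • (u b - u c) + t • (v b - v c) := by
      simp only [Pi.add_apply, Pi.smul_apply, smul_sub]; abel
    rw [this]
    calc _ ≤ ‖s • (u b - u c)‖ + ‖t • (v b - v c)‖ := norm_add_le _ _
      _ = s * ‖u b - u c‖ + t * ‖v b - v c‖ := by
        rw [norm_smul, norm_smul, Real.norm_of_nonneg hs, Real.norm_of_nonneg ht]
      _ ≤ s * dist b c + t * dist b c := by gcongr; exacts [hu b c, hv b c]
      _ = dist b c := by rw [← add_mul, hst, one_mul]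
  have hFP : ∀ x, F x ⊆ P := fun x e he b c => by simpa [dist_eq_norm] using hlip x e he b c
  -- A neighbourhood of zero controlling the first `n` terms of the dense sequence; `V 0` is
  -- everything, so the first approximation carries no constraint.
  let V : ℕ → Set (B → W) := fun n => {e | ∀ k < n, ‖e (f k)‖ < 2⁻¹ ^ n}
  have hVeq : ∀ n, V n = ⋂ k ∈ Finset.range n, (fun e : B → W => e (f k)) ⁻¹'
      Metric.ball 0 (2⁻¹ ^ n) := fun n => by
    ext e; simp [V]
  have hVo : ∀ n, IsOpen (V n) := fun n => by
    rw [hVeq]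
    exact isOpen_biInter_finset fun k _ => Metric.isOpen_ball.preimage (continuous_apply (A := fun _ : B => W) (f k))
  have hVc : ∀ n, Convex ℝ (V n) := fun n => by
    rw [hVeq]
    exact convex_iInter₂ fun k _ =>
      (convex_ball (0 : W) _).linear_preimage (LinearMap.proj (R := ℝ) (φ := fun _ : B => W) (f k))
  have hV0 : ∀ n, (0 : B → W) ∈ V n := fun n k _ => by simp
  let S : ℕ → Type _ := fun n => {g : C(X, B → W) // ∀ x, g x ∈ P ∧ ∃ e ∈ F x, e - g x ∈ V n}
  have step : ∀ n (g : S n), ∃ g' : S (n + 1), ∀ x, g'.1 x - g.1 x ∈ V n := by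
    intro n g
    obtain ⟨g', hg'⟩ := hF.exists_continuous_approx hconv hP hFP (hVc n) (hVo n) (hVc (n + 1))
      (hVo (n + 1)) (hV0 (n + 1)) g.1 fun x => (g.2 x).2
    exact ⟨⟨g', fun x => (hg' x).2⟩, fun x => (hg' x).1⟩
  obtain ⟨g₀⟩ : Nonempty (S 0) := by
    obtain ⟨g', hg'⟩ := hF.exists_continuous_approx hconv hP hFP convex_univ isOpen_univ (hVc 0)
      (hVo 0) (hV0 0) 0 fun x => (hne x).imp fun e he => ⟨he, mem_univ _⟩
    exact ⟨⟨g', fun x => (hg' x).2⟩⟩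
  choose next hnext using step
  obtain ⟨G, hGF, hG⟩ : ∃ G : ℕ → C(X, B → W),
      (∀ n x, G n x ∈ P ∧ ∃ e ∈ F x, e - G n x ∈ V n) ∧
      ∀ n x, G (n + 1) x - G n x ∈ V n := by
    let G : ∀ n, S n := fun n => Nat.rec g₀ (fun n g => next n g) n
    exact ⟨fun n => (G n).1, fun n => (G n).2, fun n => hnext n (G n)⟩
  let T : B → ℕ → C(X, W) := fun b n => ⟨fun x => G n x b, by fun_prop⟩
  have hTlip : ∀ n b c, dist (T b n) (T c n) ≤ dist b c := fun n b c =>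
    (ContinuousMap.dist_le dist_nonneg).2 fun x => by
      rw [dist_eq_norm]; exact (hGF n x).1 b c
  -- The increments at `f k` are controlled by a geometric series from index `k + 1` on.
  have hTf : ∀ k, CauchySeq (T (f k)) := by
    intro k
    refine (cauchySeq_shift (k + 1)).mp ?_
    refine cauchySeq_of_le_geometric 2⁻¹ 1 (by norm_num) fun n => ?_
    refine (ContinuousMap.dist_le (by positivity)).2 fun x => ?_
    rw [dist_comm, dist_eq_norm, one_mul]
    have := hG (n + (k + 1)) x k (by omega)
    rw [show n + 1 + (k + 1) = n + (k + 1) + 1 by ring]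
    exact this.le.trans (pow_le_pow_of_le_one (by norm_num) (by norm_num) (by omega))
  have hTc : ∀ b, CauchySeq (T b) := by
    intro b
    rw [Metric.cauchySeq_iff']
    intro ε hε
    obtain ⟨k, hk⟩ := hf.exists_dist_lt b (show 0 < ε / 3 by positivity)
    obtain ⟨N, hN⟩ := Metric.cauchySeq_iff'.mp (hTf k) (ε / 3) (by positivity)
    refine ⟨N, fun n hn => ?_⟩
    have h1 := dist_triangle4 (T b n) (T (f k) n) (T (f k) N) (T b N)
    have h2 := hTlip n b (f k)
    have h3 := hTlip N (f k) b
    rw [dist_comm (f k) b] at h3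
    linarith [hN n hn]
  choose L hL using fun b => cauchySeq_tendsto_of_complete (hTc b)
  refine ⟨⟨fun x b => L b x, by fun_prop⟩, fun x => ?_⟩
  choose e he heV using fun n => (hGF n x).2
  refine mem_closure_of_tendsto (f := e) (b := atTop) ?_ (Eventually.of_forall he)
  rw [tendsto_pi_nhds]
  intro b
  have hLx : Tendsto (fun n => G n x b) atTop (𝓝 (L b x)) :=
    ((ContinuousEvalConst.continuous_eval_const (F := C(X, W)) x).tendsto _).comp (hL b)
  suffices h : Tendsto (fun n => e n b - G n x b) atTop (𝓝 0) by
    simpa using h.add hLx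
  rw [Metric.tendsto_atTop]
  intro ε hε
  obtain ⟨k, hk⟩ := hf.exists_dist_lt b (show 0 < ε / 3 by positivity)
  obtain ⟨N, hN⟩ := exists_pow_lt_of_lt_one (show 0 < ε / 3 by positivity)
    (show (2⁻¹ : ℝ) < 1 by norm_num)
  refine ⟨max N (k + 1), fun n hn => ?_⟩
  have hn1 : N ≤ n := le_of_max_le_left hn
  have hn2 : k < n := le_of_max_le_right hn
  have h1 := heV n k hn2
  have h2 : (2⁻¹ : ℝ) ^ n ≤ 2⁻¹ ^ N := pow_le_pow_of_le_one (by norm_num) (by norm_num) hn1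
  have h3 := hFP x (he n) b (f k)
  have h4 := (hGF n x).1 (f k) b
  rw [dist_comm (f k) b] at h4
  rw [dist_zero_right]
  have h5 : e n b - G n x b = (e n b - e n (f k)) + (e n - G n x) (f k)
      + (G n x (f k) - G n x b) := by
    simp only [Pi.sub_apply]; abel
  rw [h5]
  refine (norm_add₃_le).trans_lt ?_
  linarith

end PointwiseSelection

/-! ### Supports of positive operators on `C(X)` -/

section PositiveSupport

variable {X : Type*} [TopologicalSpace X]

/-- The support of the positive functional `b ↦ L b y`: the points `z` such that the functional is
nonzero on every positive function that does not vanish at `z`. This is the support of the measure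
representing the functional, expressed without the measure. -/
def positiveSupport [CompactSpace X] (L : C(X, ℂ) →L[ℂ] C(X, ℂ)) (y : X) : Set X :=
  {z | ∀ b : C(X, ℂ), 0 ≤ b → b z ≠ 0 → L b y ≠ 0}

/-- A real continuous function as a complex one. -/
def ContinuousMap.toComplex (f : C(X, ℝ)) : C(X, ℂ) := ⟨fun x => (f x : ℂ), by fun_prop⟩

@[simp]
theorem ContinuousMap.toComplex_apply (f : C(X, ℝ)) (x : X) : f.toComplex x = (f x : ℂ) := rfl

theorem ContinuousMap.toComplex_nonneg {f : C(X, ℝ)} (hf : ∀ x, 0 ≤ f x) : 0 ≤ f.toComplex :=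
  ContinuousMap.le_def.mpr fun x => Complex.zero_le_real.mpr (hf x)

theorem ContinuousMap.tsupport_toComplex_subset (f : C(X, ℝ)) :
    tsupport f.toComplex ⊆ tsupport f :=
  closure_mono fun x hx => by simpa using hx

variable [CompactSpace X]

theorem isClosed_positiveSupport (L : C(X, ℂ) →L[ℂ] C(X, ℂ)) (y : X) :
    IsClosed (positiveSupport L y) := by
  rw [← isOpen_compl_iff, isOpen_iff_mem_nhds]
  intro z hz
  simp only [positiveSupport, mem_compl_iff, mem_ofPred, not_forall, not_not] at hz
  obtain ⟨b, hb, hbz, hLb⟩ := hz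
  filter_upwards [(map_continuous b).continuousAt.eventually_ne hbz] with w hw hwS
  exact hwS b hb hw hLb

/-- If `K` misses the support of `b ↦ L b y`, finitely many positive functions killed by the
functional add up to one that is strictly positive on `K`. -/
theorem exists_nonneg_ne_zero_of_disjoint_positiveSupport
    {L : C(X, ℂ) →L[ℂ] C(X, ℂ)} {y : X} {K : Set X} (hK : IsCompact K)
    (hd : ∀ z ∈ K, z ∉ positiveSupport L y) :
    ∃ c : C(X, ℂ), 0 ≤ c ∧ L c y = 0 ∧ ∀ z ∈ K, c z ≠ 0 := by
  refine hK.induction_on (p := fun s => ∃ c : C(X, ℂ), 0 ≤ c ∧ L c y = 0 ∧ ∀ z ∈ s, c z ≠ 0)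
    ⟨0, le_rfl, by simp, by simp⟩ ?_ ?_ ?_
  · rintro s t hst ⟨c, hc, hLc, hct⟩
    exact ⟨c, hc, hLc, fun z hz => hct z (hst hz)⟩
  · rintro s t ⟨c, hc, hLc, hcs⟩ ⟨d, hd, hLd, hdt⟩
    refine ⟨c + d, add_nonneg hc hd, by simp [hLc, hLd], fun z hz h => ?_⟩
    obtain ⟨h1, h2⟩ := (add_eq_zero_iff_of_nonneg (ContinuousMap.le_def.mp hc z)
      (ContinuousMap.le_def.mp hd z)).mp h
    exact hz.elim (fun h => hcs z h h1) fun h => hdt z h h2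
  · intro z hz
    have := hd z hz
    simp only [positiveSupport, mem_ofPred, not_forall, not_not] at this
    obtain ⟨b, hb, hbz, hLb⟩ := this
    exact ⟨{w | b w ≠ 0}, mem_nhdsWithin_of_mem_nhds
      ((map_continuous b).continuousAt.eventually_ne hbz), b, hb, hLb, fun w hw => hw⟩

/-- A positive function on which the functional `b ↦ L b y` does not vanish meets the support of
that functional. -/
theorem exists_mem_positiveSupport
    {L : C(X, ℂ) →L[ℂ] C(X, ℂ)} (hL : ∀ a, 0 ≤ a → 0 ≤ L a) {y : X} {b : C(X, ℂ)} (hb : 0 ≤ b)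
    (hLb : L b y ≠ 0) : ∃ z ∈ tsupport b, z ∈ positiveSupport L y := by
  by_contra! hd
  have hK : IsCompact (tsupport b) := (isClosed_tsupport _).isCompact
  obtain ⟨c, hc, hLc, hcK⟩ := exists_nonneg_ne_zero_of_disjoint_positiveSupport hK hd
  -- Compactness gives `b ≤ M • c` with `c` killed by the functional, hence `L b y ≤ 0`.
  obtain ⟨M, hM⟩ := hK.exists_bound_of_continuousOn (f := fun z => b z / c z)
    ((map_continuous b).continuousOn.div (map_continuous c).continuousOn hcK)
  have hle : 0 ≤ ((|M| : ℝ) : ℂ) • c - b := by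
    refine ContinuousMap.le_def.mpr fun z => ?_
    have hcz : 0 ≤ c z := ContinuousMap.le_def.mp hc z
    have hbz : 0 ≤ b z := ContinuousMap.le_def.mp hb z
    have hn : ‖b z‖ ≤ |M| * ‖c z‖ := by
      by_cases hz : z ∈ tsupport b
      · have h := (hM z hz).trans (le_abs_self M)
        rwa [norm_div, div_le_iff₀ (norm_pos_iff.mpr (hcK z hz))] at h
      · rw [image_eq_zero_of_notMem_tsupport hz, norm_zero]
        positivity
    have h : (0 : ℂ) ≤ ((|M| * ‖c z‖ - ‖b z‖ : ℝ) : ℂ) :=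
      Complex.zero_le_real.mpr (sub_nonneg.mpr hn)
    rwa [Complex.ofReal_sub, Complex.ofReal_mul, Complex.norm_of_nonneg' hbz,
      Complex.norm_of_nonneg' hcz] at h
  have h1 : 0 ≤ L (((|M| : ℝ) : ℂ) • c - b) y := ContinuousMap.le_def.mp (hL _ hle) y
  have h2 : 0 ≤ L b y := ContinuousMap.le_def.mp (hL _ hb) y
  rw [map_sub, map_smul, ContinuousMap.sub_apply, ContinuousMap.smul_apply, hLc, smul_zero,
    zero_sub] at h1
  exact hLb (le_antisymm (neg_nonneg.mp h1) h2)

end PositiveSupport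

/-! ### From transfer operators to sections -/

section TransferToSection

variable {X : Type*} [TopologicalSpace X] {Δ : TopologicalSpace.Clopens X} {γ : C(Δ, X)}

theorem partialCompEnd_apply_coe (a : C(X, ℂ)) (z : Δ) :
    partialCompEnd Δ γ a z = a (γ z) := by
  simp [partialCompEnd]

theorem partialCompEnd_apply_of_notMem (a : C(X, ℂ)) {x : X} (hx : x ∉ Δ) :
    partialCompEnd Δ γ a x = 0 := by
  simp [partialCompEnd, hx]

theorem partialCompEnd_nonneg {a : C(X, ℂ)} (ha : 0 ≤ a) : 0 ≤ partialCompEnd Δ γ a := by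
  refine ContinuousMap.le_def.mpr fun x => ?_
  by_cases hx : x ∈ Δ
  · rw [partialCompEnd_apply_coe a ⟨x, hx⟩]
    exact ContinuousMap.le_def.mp ha (γ ⟨x, hx⟩)
  · rw [partialCompEnd_apply_of_notMem a hx]; rfl

variable [CompactSpace X] {L : C(X, ℂ) →L[ℂ] C(X, ℂ)}

theorem IsTransferOperator.apply_partialCompEnd
    (hL : IsTransferOperator (partialCompEnd Δ γ) L) (a : C(X, ℂ)) :
    L (partialCompEnd Δ γ a) = a * L 1 := by
  simpa using hL.map_mul a 1

/-- If `L 1 = 0` then all supports are empty, so `L` kills the positive elements, which span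
`C(X)`. -/
theorem IsTransferOperator.apply_one_ne_zero
    (hL : IsTransferOperator (partialCompEnd Δ γ) L) (h0 : L ≠ 0) : L 1 ≠ 0 := by
  intro h1
  apply h0
  have hpos : ∀ a : C(X, ℂ), 0 ≤ a → L a = 0 := by
    intro a ha
    ext y
    by_contra hy
    obtain ⟨z, -, hz⟩ := exists_mem_positiveSupport hL.nonneg ha hy
    exact hz 1 zero_le_one one_ne_zero (by simp [h1])
  have hspan : Submodule.span ℂ {a : C(X, ℂ) | 0 ≤ a} ≤
      LinearMap.ker (L : C(X, ℂ) →ₗ[ℂ] C(X, ℂ)) :=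
    Submodule.span_le.mpr hpos
  rw [CStarAlgebra.span_nonneg] at hspan
  ext1 a
  exact hspan (Submodule.mem_top (x := a))

variable [T2Space X]

theorem IsTransferOperator.mem_range_of_apply_one_ne_zero
    (hL : IsTransferOperator (partialCompEnd Δ γ) L) {y : X} (hy : L 1 y ≠ 0) : y ∈ range γ := by
  by_contra hyr
  have : CompactSpace Δ := isCompact_iff_compactSpace.mp Δ.isClopen.isClosed.isCompact
  obtain ⟨f, hf0, hf1, -⟩ := exists_continuous_zero_one_of_isClosed
    (isCompact_range (map_continuous γ)).isClosed (isClosed_singleton (x := y))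
    (disjoint_singleton_right.mpr hyr)
  have h0 : partialCompEnd Δ γ f.toComplex = 0 := by
    ext x
    by_cases hx : x ∈ Δ
    · rw [partialCompEnd_apply_coe _ ⟨x, hx⟩]
      simpa using hf0 (mem_range_self (⟨x, hx⟩ : Δ))
    · exact partialCompEnd_apply_of_notMem _ hx
  have h := congr($(hL.apply_partialCompEnd f.toComplex) y)
  rw [h0, map_zero] at h
  apply hy
  simpa [hf1 rfl] using h.symm

theorem IsTransferOperator.mem_interior_range
    (hL : IsTransferOperator (partialCompEnd Δ γ) L) {y : X} (hy : L 1 y ≠ 0) :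
    y ∈ interior (range γ) :=
  mem_interior.mpr ⟨{x | L 1 x ≠ 0}, fun _ hx => hL.mem_range_of_apply_one_ne_zero hx,
    isOpen_ne_fun (map_continuous _) continuous_const, hy⟩

/-- The supports of the functionals `b ↦ L b y` form a lower semicontinuous section, which is
nonempty wherever `L 1` does not vanish. -/
theorem IsTransferOperator.exists_isLSCSection
    (hL : IsTransferOperator (partialCompEnd Δ γ) L) :
    ∃ Φ : range γ → TopologicalSpace.Closeds Δ, IsLSCSection γ Φ ∧
      ∀ y : range γ, L 1 y ≠ 0 → (Φ y : Set Δ).Nonempty := by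
  -- Restricting the supports to `Δ` loses nothing, as `L` only sees functions on `Δ`.
  refine ⟨fun y => ⟨(↑) ⁻¹' positiveSupport L y,
    (isClosed_positiveSupport L y).preimage continuous_subtype_val⟩, ⟨?_, ?_⟩, ?_⟩
  · intro y z hz
    by_contra hne
    obtain ⟨f, hf0, hf1, hf⟩ := exists_continuous_zero_one_of_isClosed
      (isClosed_singleton (x := (y : X))) (isClosed_singleton (x := γ z))
      (disjoint_singleton.mpr (Ne.symm hne))
    refine hz (partialCompEnd Δ γ f.toComplex)
      (partialCompEnd_nonneg (ContinuousMap.toComplex_nonneg fun x => (hf x).1)) ?_ ?_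
    · rw [partialCompEnd_apply_coe]
      simp [hf1 rfl]
    · rw [hL.apply_partialCompEnd]
      simp [hf0 rfl]
  · intro y
    refine lowerHemicontinuousAt_iff.mpr ?_
    rintro u hu ⟨z, hz, hzu⟩
    have hu' : IsOpen ((↑) '' u : Set X) := Δ.isClopen.isOpen.isOpenMap_subtype_val u hu
    obtain ⟨f, hfs, hf1, hf⟩ := exists_tsupport_one_of_isOpen_isClosed hu'
      isClosed_closure.isCompact (isClosed_singleton (x := (z : X)))
      (singleton_subset_iff.mpr (mem_image_of_mem _ hzu))
    have hf0 : 0 ≤ f.toComplex := ContinuousMap.toComplex_nonneg fun x => (hf x).1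
    have hLf : L f.toComplex y ≠ 0 := hz _ hf0 (by simp [hf1 rfl])
    have hev : ∀ᶠ y' : range γ in 𝓝 y, L f.toComplex y' ≠ 0 :=
      ((map_continuous (L f.toComplex)).comp continuous_subtype_val).continuousAt.eventually_ne hLf
    filter_upwards [hev] with y' hy'
    obtain ⟨w, hw, hwS⟩ := exists_mem_positiveSupport hL.nonneg hf0 hy'
    obtain ⟨v, hv, rfl⟩ := hfs (f.tsupport_toComplex_subset hw)
    exact ⟨v, hwS, hv⟩
  · intro y hy
    -- Testing with `α 1`, the indicator function of `Δ`, gives a point of the support inside `Δ`.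
    have h1 : L (partialCompEnd Δ γ 1) y ≠ 0 := by
      rwa [hL.apply_partialCompEnd, one_mul]
    obtain ⟨w, hw, hwS⟩ := exists_mem_positiveSupport hL.nonneg
      (partialCompEnd_nonneg zero_le_one) h1
    have hsub : tsupport (partialCompEnd Δ γ 1) ⊆ Δ := by
      refine closure_minimal (fun x hx => ?_) Δ.isClopen.isClosed
      by_contra hxΔ
      exact hx (partialCompEnd_apply_of_notMem _ hxΔ)
    exact ⟨⟨w, hsub hw⟩, hwS⟩

end TransferToSection

/-! ### From sections to transfer operators -/

section SectionToTransfer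

variable {X : Type*} [TopologicalSpace X] {Δ : TopologicalSpace.Clopens X} {γ : C(Δ, X)}

/-- The weighted evaluations `b ↦ ρ y * b z` at the points `z` of `Φ y`, together with the zero
functional if `ρ y = 0`. These are plain functions on `C(X)`, so that the relevant topology is the
product topology. -/
def weightedEvaluations (Φ : range γ → TopologicalSpace.Closeds Δ) (ρ : C(X, ℝ)) (y : X) :
    Set (C(X, ℂ) → ℂ) :=
  {e | (ρ y = 0 ∧ e = 0) ∨ ∃ (hy : y ∈ range γ), ∃ z ∈ Φ ⟨y, hy⟩, e = fun b => (ρ y : ℂ) * b z}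

theorem weightedEvaluations_nonempty {Φ : range γ → TopologicalSpace.Closeds Δ} {ρ : C(X, ℝ)}
    (hne : ∀ x, ρ x ≠ 0 → ∃ hx : x ∈ range γ, (Φ ⟨x, hx⟩ : Set Δ).Nonempty) (y : X) :
    (weightedEvaluations Φ ρ y).Nonempty := by
  by_cases h0 : ρ y = 0
  · exact ⟨0, Or.inl ⟨h0, rfl⟩⟩
  · obtain ⟨hy, z, hz⟩ := hne y h0
    exact ⟨_, Or.inr ⟨hy, z, hz, rfl⟩⟩

variable [CompactSpace X]

/-- The conditions on a function `e` on `C(X)` that are needed for `e b = L b y` with a contractive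
transfer operator `L` such that `L 1 = ρ`. All of them are convex and pointwise closed, so they
pass from weighted evaluations to the selection. -/
structure IsTransferFunctional (γ : C(Δ, X)) (ρ : C(X, ℝ)) (y : X) (e : C(X, ℂ) → ℂ) :
    Prop where
  map_add : ∀ a b, e (a + b) = e a + e b
  map_smul : ∀ (c : ℂ) a, e (c • a) = c * e a
  norm_le : ∀ a, ‖e a‖ ≤ ‖a‖
  nonneg : ∀ a, 0 ≤ a → 0 ≤ e a
  map_mul : ∀ a b, e (partialCompEnd Δ γ a * b) = a y * e b
  map_one : e 1 = ρ y

theorem convex_isTransferFunctional (ρ : C(X, ℝ)) (y : X) :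
    Convex ℝ {e | IsTransferFunctional γ ρ y e} := by
  intro u hu v hv s t hs ht hst
  refine ⟨fun a b => ?_, fun c a => ?_, fun a => ?_, fun a ha => ?_, fun a b => ?_, ?_⟩
  · simp only [Pi.add_apply, Pi.smul_apply, hu.map_add, hv.map_add, smul_add]; abel
  · simp only [Pi.add_apply, Pi.smul_apply, hu.map_smul, hv.map_smul, Complex.real_smul]; ring
  · calc ‖s • u a + t • v a‖ ≤ ‖s • u a‖ + ‖t • v a‖ := norm_add_le _ _
      _ = s * ‖u a‖ + t * ‖v a‖ := by
        rw [norm_smul, norm_smul, Real.norm_of_nonneg hs, Real.norm_of_nonneg ht]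
      _ ≤ s * ‖a‖ + t * ‖a‖ := by gcongr; exacts [hu.norm_le a, hv.norm_le a]
      _ = ‖a‖ := by rw [← add_mul, hst, one_mul]
  · simp only [Pi.add_apply, Pi.smul_apply, Complex.real_smul]
    exact add_nonneg (mul_nonneg (Complex.zero_le_real.mpr hs) (hu.nonneg a ha))
      (mul_nonneg (Complex.zero_le_real.mpr ht) (hv.nonneg a ha))
  · simp only [Pi.add_apply, Pi.smul_apply, hu.map_mul, hv.map_mul, Complex.real_smul]; ring
  · simp only [Pi.add_apply, Pi.smul_apply, hu.map_one, hv.map_one]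
    rw [← add_smul, hst, one_smul]

theorem isClosed_isTransferFunctional (ρ : C(X, ℝ)) (y : X) :
    IsClosed {e | IsTransferFunctional γ ρ y e} := by
  have h : {e | IsTransferFunctional γ ρ y e} =
      {e | ∀ a b, e (a + b) = e a + e b} ∩ {e | ∀ (c : ℂ) a, e (c • a) = c * e a} ∩
      {e | ∀ a, ‖e a‖ ≤ ‖a‖} ∩ {e | ∀ a, 0 ≤ a → 0 ≤ e a} ∩
      {e | ∀ a b, e (partialCompEnd Δ γ a * b) = a y * e b} ∩ {e | e 1 = (ρ y : ℂ)} := by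
    ext e
    constructor
    · rintro ⟨h1, h2, h3, h4, h5, h6⟩
      exact ⟨⟨⟨⟨⟨h1, h2⟩, h3⟩, h4⟩, h5⟩, h6⟩
    · rintro ⟨⟨⟨⟨⟨h1, h2⟩, h3⟩, h4⟩, h5⟩, h6⟩
      exact ⟨h1, h2, h3, h4, h5, h6⟩
  rw [h]
  simp only [ofPred_forall]
  refine ((((IsClosed.inter ?_ ?_).inter ?_).inter ?_).inter ?_).inter ?_
  · exact isClosed_iInter fun a => isClosed_iInter fun b => isClosed_eq (by fun_prop) (by fun_prop)
  · exact isClosed_iInter fun a => isClosed_iInter fun b => isClosed_eq (by fun_prop) (by fun_prop)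
  · exact isClosed_iInter fun a => isClosed_le (by fun_prop) (by fun_prop)
  · exact isClosed_iInter fun a => isClosed_iInter fun _ =>
      isClosed_le continuous_const (by fun_prop)
  · exact isClosed_iInter fun a => isClosed_iInter fun b => isClosed_eq (by fun_prop) (by fun_prop)
  · exact isClosed_eq (by fun_prop) (by fun_prop)

theorem isTransferFunctional_of_mem_weightedEvaluations
    {Φ : range γ → TopologicalSpace.Closeds Δ} (hΦ : IsLSCSection γ Φ) {ρ : C(X, ℝ)}
    (hρ : ∀ x, ρ x ∈ Icc (0 : ℝ) 1) {y : X} {e : C(X, ℂ) → ℂ}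
    (he : e ∈ weightedEvaluations Φ ρ y) : IsTransferFunctional γ ρ y e := by
  obtain ⟨h0, rfl⟩ | ⟨hy, z, hz, rfl⟩ := he
  · constructor <;> simp [h0]
  · have hγ : γ z = y := hΦ.subset_fiber ⟨y, hy⟩ hz
    refine ⟨fun a b => ?_, fun c a => ?_, fun a => ?_, fun a ha => ?_, fun a b => ?_, ?_⟩
    · simp [mul_add]
    · simp only [ContinuousMap.smul_apply, smul_eq_mul]; ring
    · rw [norm_mul, Complex.norm_real, Real.norm_of_nonneg (hρ y).1]
      exact (mul_le_of_le_one_left (norm_nonneg _) (hρ y).2).trans (a.norm_coe_le_norm z)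
    · exact mul_nonneg (Complex.zero_le_real.mpr (hρ y).1) (ContinuousMap.le_def.mp ha z)
    · rw [ContinuousMap.mul_apply, partialCompEnd_apply_coe, hγ]; ring
    · simp

theorem norm_le_of_mem_weightedEvaluations
    {Φ : range γ → TopologicalSpace.Closeds Δ} {ρ : C(X, ℝ)} {y : X} {e : C(X, ℂ) → ℂ}
    (he : e ∈ weightedEvaluations Φ ρ y) (b : C(X, ℂ)) : ‖e b‖ ≤ ‖ρ y‖ * ‖b‖ := by
  obtain ⟨h0, rfl⟩ | ⟨hy, z, hz, rfl⟩ := he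
  · simp [h0]
  · rw [norm_mul, Complex.norm_real]
    gcongr
    exact b.norm_coe_le_norm z

/-- Where `ρ` does not vanish, lower hemicontinuity comes from that of `Φ`, since `y` is then
interior to the range of `γ`; at the zeros of `ρ`, all weighted evaluations at nearby points are
small. -/
theorem lowerHemicontinuous_weightedEvaluations
    {Φ : range γ → TopologicalSpace.Closeds Δ} (hΦ : IsLSCSection γ Φ) {ρ : C(X, ℝ)}
    (hne : ∀ x, ρ x ≠ 0 → ∃ hx : x ∈ range γ, (Φ ⟨x, hx⟩ : Set Δ).Nonempty) :
    LowerHemicontinuous (weightedEvaluations Φ ρ) := by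
  intro y
  refine lowerHemicontinuousAt_iff.mpr ?_
  rintro U hU ⟨e, he, heU⟩
  by_cases h0 : ρ y = 0
  · have he0 : e = 0 := by
      ext b
      simpa [h0] using norm_le_of_mem_weightedEvaluations he b
    subst he0
    choose d hd using weightedEvaluations_nonempty hne
    have hlim : Tendsto d (𝓝 y) (𝓝 0) := by
      refine tendsto_pi_nhds.mpr fun b => ?_
      refine squeeze_zero_norm (fun x => norm_le_of_mem_weightedEvaluations (hd x) b) ?_
      have : Tendsto (fun x => ‖ρ x‖ * ‖b‖) (𝓝 y) (𝓝 (‖ρ y‖ * ‖b‖)) :=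
        (by fun_prop : Continuous fun x => ‖ρ x‖ * ‖b‖).tendsto y
      simpa [h0] using this
    filter_upwards [hlim.eventually_mem (hU.mem_nhds heU)] with x hx
    exact ⟨d x, hd x, hx⟩
  · obtain ⟨h, -⟩ | ⟨hy, z, hz, rfl⟩ := he
    · exact absurd h h0
    have hcont : Continuous fun p : X × Δ => fun b : C(X, ℂ) => (ρ p.1 : ℂ) * b p.2 := by
      fun_prop
    obtain ⟨V, W, hV, hW, hyV, hzW, hVW⟩ := isOpen_prod_iff.mp (hU.preimage hcont) y z heU
    have hr : range γ ∈ 𝓝 y :=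
      mem_of_superset ((map_continuous ρ).continuousAt.eventually_ne h0) fun x hx => (hne x hx).1
    have hev : ∀ᶠ x : range γ in 𝓝 ⟨y, hy⟩, ((Φ x : Set Δ) ∩ W).Nonempty :=
      lowerHemicontinuousAt_iff.mp (hΦ.lsc ⟨y, hy⟩) W hW ⟨z, hz, hzW⟩
    rw [nhds_subtype_eq_comap_nhdsWithin, nhdsWithin_eq_nhds.mpr hr, eventually_comap] at hev
    filter_upwards [hev, hr, hV.mem_nhds hyV] with x hx hxr hxV
    obtain ⟨w, hw, hwW⟩ := hx ⟨x, hxr⟩ rfl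
    exact ⟨_, Or.inr ⟨hxr, w, hw, rfl⟩, hVW (mk_mem_prod hxV hwW)⟩

/-- The values at `y` of the operator form a continuous selection of the pointwise closed convex
hull of the weighted evaluations. -/
theorem IsLSCSection.exists_isTransferOperator [TopologicalSpace.MetrizableSpace X]
    {Φ : range γ → TopologicalSpace.Closeds Δ} (hΦ : IsLSCSection γ Φ) {ρ : C(X, ℝ)}
    (hρ : ∀ x, ρ x ∈ Icc (0 : ℝ) 1)
    (hne : ∀ x, ρ x ≠ 0 → ∃ hx : x ∈ range γ, (Φ ⟨x, hx⟩ : Set Δ).Nonempty) :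
    ∃ L : C(X, ℂ) →L[ℂ] C(X, ℂ),
      IsTransferOperator (partialCompEnd Δ γ) L ∧ L 1 = ρ.toComplex := by
  have hsub : ∀ y, convexHull ℝ (weightedEvaluations Φ ρ y) ⊆
      {e | IsTransferFunctional γ ρ y e} := fun y =>
    convexHull_min (fun e he => isTransferFunctional_of_mem_weightedEvaluations hΦ hρ he)
      (convex_isTransferFunctional ρ y)
  obtain ⟨g, hg⟩ :=
    (lowerHemicontinuous_weightedEvaluations hΦ hne).convexHull.exists_continuous_mem_closure
      (fun y => convex_convexHull ℝ _) (fun y => (weightedEvaluations_nonempty hne y).convexHull)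
      (fun y e he b c => by
        have h := hsub y he
        have hbc : e b = e (b - c) + e c := by rw [← h.map_add, sub_add_cancel]
        rw [dist_eq_norm, dist_eq_norm, hbc, add_sub_cancel_right]
        exact h.norm_le _)
  have hT : ∀ y, IsTransferFunctional γ ρ y (g y) := fun y =>
    closure_minimal (hsub y) (isClosed_isTransferFunctional ρ y) (hg y)
  let L : C(X, ℂ) →ₗ[ℂ] C(X, ℂ) :=
    { toFun := fun b => ⟨fun y => g y b, by fun_prop⟩
      map_add' := fun a b => ContinuousMap.ext fun y => (hT y).map_add a b
      map_smul' := fun c a => ContinuousMap.ext fun y => (hT y).map_smul c a }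
  refine ⟨L.mkContinuous 1 fun a => ?_, ⟨fun a ha => ?_, fun a b => ?_⟩, ?_⟩
  · rw [one_mul]
    exact (ContinuousMap.norm_le _ (norm_nonneg _)).mpr fun y => (hT y).norm_le a
  · exact ContinuousMap.le_def.mpr fun y => (hT y).nonneg a ha
  · exact ContinuousMap.ext fun y => (hT y).map_mul a b
  · exact ContinuousMap.ext fun y => (hT y).map_one

end SectionToTransfer

/-! ### Existence criteria -/

theorem mainTheorem3 {X : Type*} [TopologicalSpace X] [CompactSpace X]
    [TopologicalSpace.MetrizableSpace X]
    (Δ : TopologicalSpace.Clopens X) (γ : C(Δ, X)) :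
    ((∃ L : C(X, ℂ) →L[ℂ] C(X, ℂ), IsTransferOperator (partialCompEnd Δ γ) L ∧ L ≠ 0) ↔
      ∃ Φ : Set.range γ → TopologicalSpace.Closeds Δ, IsLSCSection γ Φ ∧
        ∃ x : Set.range γ, (x : X) ∈ interior (Set.range γ) ∧ (Φ x : Set Δ).Nonempty) ∧
    ((∃ L : C(X, ℂ) →L[ℂ] C(X, ℂ), IsNonDegenerateTransferOperator (partialCompEnd Δ γ) L) ↔
      IsOpen (Set.range γ) ∧
        ∃ Φ : Set.range γ → TopologicalSpace.Closeds Δ, IsLSCSection γ Φ ∧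
          ∀ x : Set.range γ, (Φ x : Set Δ).Nonempty) := by
  refine ⟨⟨?_, ?_⟩, ⟨?_, ?_⟩⟩
  · rintro ⟨L, hL, h0⟩
    obtain ⟨y, hy⟩ : ∃ y, L 1 y ≠ 0 := by
      by_contra! h
      exact hL.apply_one_ne_zero h0 (ContinuousMap.ext h)
    obtain ⟨Φ, hΦ, hne⟩ := hL.exists_isLSCSection
    exact ⟨Φ, hΦ, ⟨y, hL.mem_range_of_apply_one_ne_zero hy⟩, hL.mem_interior_range hy, hne _ hy⟩
  · rintro ⟨Φ, hΦ, y, hy, hne⟩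
    -- The set where `Φ` is nonempty is a neighbourhood of `y` in `X`, not just in the range,
    -- because `y` is interior to the range.
    have hU : {x : X | ∃ hx : x ∈ range γ, (Φ ⟨x, hx⟩ : Set Δ).Nonempty} ∈ 𝓝 (y : X) := by
      have hev : ∀ᶠ x : range γ in 𝓝 y, ((Φ x : Set Δ) ∩ univ).Nonempty :=
        lowerHemicontinuousAt_iff.mp (hΦ.lsc y) univ isOpen_univ (by simpa using hne)
      have hr : range γ ∈ 𝓝 (y : X) := mem_interior_iff_mem_nhds.mp hy
      rw [nhds_subtype_eq_comap_nhdsWithin, nhdsWithin_eq_nhds.mpr hr, eventually_comap] at hev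
      filter_upwards [hev, hr] with x hx hxr
      exact ⟨hxr, by simpa using hx ⟨x, hxr⟩ rfl⟩
    obtain ⟨U, hUsub, hUo, hyU⟩ := mem_nhds_iff.mp hU
    obtain ⟨ρ, hρ0, hρ1, hρ⟩ := exists_continuous_zero_one_of_isClosed hUo.isClosed_compl
      (isClosed_singleton (x := (y : X))) (disjoint_singleton_right.mpr (not_not.mpr hyU))
    obtain ⟨L, hL, hL1⟩ := hΦ.exists_isTransferOperator hρ fun x hx => hUsub <| by
      by_contra hxU
      exact hx (hρ0 hxU)
    refine ⟨L, hL, ?_⟩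
    rintro rfl
    simpa [hρ1 rfl] using congr($hL1 (y : X))
  · rintro ⟨L, hL⟩
    have h1 : ∀ x ∈ range γ, L 1 x ≠ 0 := by
      rintro _ ⟨z, rfl⟩
      have h := congr($(hL.map_one) (z : X))
      rw [partialCompEnd_apply_coe, partialCompEnd_apply_coe] at h
      simp [h]
    obtain ⟨Φ, hΦ, hne⟩ := hL.exists_isLSCSection
    exact ⟨subset_interior_iff_isOpen.mp fun x hx => hL.mem_interior_range (h1 x hx),
      Φ, hΦ, fun x => hne x (h1 x x.2)⟩
  · rintro ⟨ho, Φ, hΦ, hne⟩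
    have : CompactSpace Δ := isCompact_iff_compactSpace.mp Δ.isClopen.isClosed.isCompact
    obtain ⟨ρ, hρ0, hρ1, hρ⟩ := exists_continuous_zero_one_of_isClosed ho.isClosed_compl
      (isCompact_range (map_continuous γ)).isClosed disjoint_compl_left
    obtain ⟨L, hL, hL1⟩ := hΦ.exists_isTransferOperator hρ fun x hx => by
      have hxr : x ∈ range γ := by
        by_contra hxr
        exact hx (hρ0 hxr)
      exact ⟨hxr, hne _⟩
    refine ⟨L, hL, ContinuousMap.ext fun x => ?_⟩
    by_cases hx : x ∈ Δ
    · rw [partialCompEnd_apply_coe _ ⟨x, hx⟩, partialCompEnd_apply_coe _ ⟨x, hx⟩, hL1]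
      simp [hρ1 (mem_range_self _)]
    · rw [partialCompEnd_apply_of_notMem _ hx, partialCompEnd_apply_of_notMem _ hx]
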